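/- **Theorem 3.6 (Strong law of large numbers).** Setting. Let $M$ be a non-empty space with a proper metric $d$ (closed balls are compact). Let $T$ be a metrisable, non-compact, unimodular topological group acting on $M$ from the left by $d$-isometries, such that the action $T\times M\to M$, $(x,m)\mapsto xm$, is continuous and proper (i.e. $(x,m)\mapsto(xm,m)$ is a proper map). Let $\mathrm{vol}$ be a Haar measure on $T$, written $\mathrm dx$. Let $\mathbb A$ be a non-empty, locally compact, second-countable Hausdorff space. Fix $r>0$ and let $\mathcal P_r(M)$ be the set of all $P\subseteq M$ such that every open ball of radius $r$ contains at most one point of $P$. For $P\in\mathcal P_r(M)$ and $\omega\in\Omega_P:=\mathbb A^P$ put $P^{(\omega)}:=\{(p,\omega(p)):p\in P\}\subseteq M\times\mathbb A$, and let $\mathcal C_r(M)$ be the set of all such coloured point sets. Equip $\mathcal P_r(M)$ and $\mathcal C_r(M)$ with the vague topology, the weakest topology for which $Q\mapsto\sum_{q\in Q}\varphi(q)$ is continuous for all $\varphi\in C_c(M)$, respectively for all $\varphi\in C_c(M\times\mathbb A)$. The group $T$ acts by $xP=\{xp:p\in P\}$ and $xQ=\{(xm,a):(m,a)\in Q\}$,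 respectively. For $\mathcal P\subseteq\mathcal P_r(M)$ let $X_{\mathcal P}:=\overline{\{xP:x\in T,\,P\in\mathcal P\}}\subseteq\mathcal P_r(M)$ and $\widehat X_{\mathcal P}:=\{P^{(\omega)}:P\in X_{\mathcal P},\,\omega\in\Omega_P\}\subseteq\mathcal C_r(M)$. Let $(D_n)_{n\in\mathbb N}$ be a Følner sequence in $T$: an increasing sequence of non-empty compact subsets of $T$ with $\bigcup_n\mathring D_n=T$ and $\mathrm{vol}\big((KD_n)\,\triangle\,D_n\big)/\mathrm{vol}(D_n)\to0$ for every non-empty compact $K\subseteq T$. Let $P\in X_{\mathcal P}$ and let $\mathbb P_P$ be a Borel probability measure on $\Omega_P$ which is independent at a distance: there is $\varrho>0$ such that for all $V_1,V_2\subseteq M$ with $d(V_1,V_2)>\varrho$ the $\sigma$-algebras on $\Omega_P$ generated by the colours of the points in $P\cap V_1$ and in $P\cap V_2$, respectively, are $\mathbb P_P$-independent. Claim. Let $f$ be a real-valued continuous function on the closure of $\widehat X_{\mathcal P}$ in $\mathcal C_r(M)$ (if $\mathbb A$ is compact, then $\widehat X_{\mathcal P}$ is closed and this says $f\in C(\widehat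 X_{\mathcal P})$). Then $$Y_n(\omega):=\frac1{\mathrm{vol}(D_n)}\int_{D_n}f(xP^{(\omega)})\,\mathrm dx\qquad(\omega\in\Omega_P,\ n\in\mathbb N)$$ is well defined (for the finitely many $n$ with $\mathrm{vol}(D_n)=0$ put $Y_n:=0$) and $\mathbb P_P$-integrable, and for $\mathbb P_P$-almost all $\omega\in\Omega_P$ $$\lim_{n\to\infty}\Big(Y_n(\omega)-\int_{\Omega_P}Y_n(\eta)\,\mathrm d\mathbb P_P(\eta)\Big)=0 .$$ -/

import Mathlib

open MeasureTheory ProbabilityTheory Filter Topology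
open scoped Pointwise CompactlySupported

noncomputable section

/-- A subset of `M` is uniformly discrete with radius `r` if every open ball of radius `r`
contains at most one of its points. -/
def IsUniformlyDiscrete {M : Type*} [MetricSpace M] (r : ℝ) (P : Set M) : Prop :=
  ∀ m : M, (P ∩ Metric.ball m r).Subsingleton

/-- The space of all point sets in `M`, that is, of all subsets of `M` which are uniformly
discrete with radius `r`. -/
def PointSet (M : Type*) [MetricSpace M] (r : ℝ) : Type _ :=
  {P : Set M // IsUniformlyDiscrete r P}

/-- The set of pairs `(p, ω p)`, `p ∈ P`: the set `P` coloured by `ω : P → A`. -/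
def colouredSet {M A : Type*} (P : Set M) (ω : P → A) : Set (M × A) :=
  Set.range fun p : P => ((p : M), ω p)

/-- The space of coloured point sets: those subsets of `M × A` which arise by colouring
a uniformly discrete set of radius `r`, each point having exactly one colour. -/
def ColouredPointSet (M A : Type*) [MetricSpace M] (r : ℝ) : Type _ :=
  {Q : Set (M × A) // ∃ (P : PointSet M r) (ω : P.1 → A), Q = colouredSet P.1 ω}

/-- The vague topology on a family of (locally finite) subsets `F i` of `X`: the weakest topology
such that `i ↦ ∑ p ∈ F i, φ p` is continuous for every continuous real function `φ` on `X`
with compact support. -/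
@[reducible] def vagueTopology {X ι : Type*} [TopologicalSpace X] (F : ι → Set X) : TopologicalSpace ι :=
  ⨅ φ : C_c(X, ℝ), TopologicalSpace.induced (fun i => ∑ᶠ p ∈ F i, φ p) inferInstance

instance instTopologicalSpacePointSet {M : Type*} [MetricSpace M] {r : ℝ} :
    TopologicalSpace (PointSet M r) :=
  vagueTopology (fun P : PointSet M r => P.1)

instance instTopologicalSpaceColouredPointSet {M A : Type*} [MetricSpace M] [TopologicalSpace A]
    {r : ℝ} : TopologicalSpace (ColouredPointSet M A r) :=
  vagueTopology (fun Q : ColouredPointSet M A r => Q.1)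

section Action

variable {T M A : Type*} [Group T] [MetricSpace M] [MulAction T M] [IsIsometricSMul T M] {r : ℝ}

theorem IsUniformlyDiscrete.smul (x : T) {P : Set M} (hP : IsUniformlyDiscrete r P) :
    IsUniformlyDiscrete r (x • P) := by
  rintro m _ ⟨⟨p, hp, rfl⟩, hpm⟩ _ ⟨⟨q, hq, rfl⟩, hqm⟩
  have key : ∀ y : M, x • y ∈ Metric.ball m r → y ∈ Metric.ball (x⁻¹ • m) r := by
    intro y hy
    have h : dist (x • y) (x • x⁻¹ • m) = dist y (x⁻¹ • m) := dist_smul x y (x⁻¹ • m)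
    rw [smul_inv_smul] at h
    rw [Metric.mem_ball, ← h]
    exact hy
  have hpq : p = q := hP (x⁻¹ • m) ⟨hp, key p hpm⟩ ⟨hq, key q hqm⟩
  rw [hpq]

/-- The action of `T` on point sets, `xP = {xp : p ∈ P}`. -/
instance instSMulPointSet : SMul T (PointSet M r) :=
  ⟨fun x P => ⟨x • P.1, P.2.smul x⟩⟩

/-- The shift of colourings, `(τ_x ω)(xp) = ω(p)`. -/
def shiftColouring (x : T) (P : PointSet M r) (ω : P.1 → A) : (x • P).1 → A :=
  fun q => ω ⟨x⁻¹ • (q : M), Set.mem_smul_set_iff_inv_smul_mem.1 q.2⟩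

theorem image_colouredSet (x : T) (P : PointSet M r) (ω : P.1 → A) :
    (fun q : M × A => (x • q.1, q.2)) '' colouredSet P.1 ω =
      colouredSet (x • P).1 (shiftColouring x P ω) := by
  ext ⟨m, a⟩
  constructor
  · rintro ⟨_, ⟨p, rfl⟩, h⟩
    obtain ⟨rfl, rfl⟩ := Prod.mk.inj h
    refine ⟨⟨x • (p : M), Set.smul_mem_smul_set p.2⟩, ?_⟩
    simp [shiftColouring]
  · rintro ⟨q, h⟩
    obtain ⟨rfl, rfl⟩ := Prod.mk.inj h
    exact ⟨_, ⟨⟨x⁻¹ • (q : M), Set.mem_smul_set_iff_inv_smul_mem.1 q.2⟩, rfl⟩,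
      by simp [shiftColouring]⟩

/-- The action of `T` on coloured point sets: `x` moves each point `(m, a)` to `(xm, a)`. -/
instance instSMulColouredPointSet : SMul T (ColouredPointSet M A r) :=
  ⟨fun x Q => ⟨(fun q : M × A => (x • q.1, q.2)) '' Q.1, by
    obtain ⟨P, ω, h⟩ := Q.2
    exact ⟨x • P, shiftColouring x P ω, by rw [h, image_colouredSet]⟩⟩⟩

end Action

/-- The coloured point set `P^(ω)`. -/
def colour {M A : Type*} [MetricSpace M] {r : ℝ} (P : PointSet M r) (ω : P.1 → A) :
    ColouredPointSet M A r :=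
  ⟨colouredSet P.1 ω, P, ω, rfl⟩

/-- The closed `T`-orbit of a collection `S` of point sets. -/
def hull (T : Type*) {M : Type*} [Group T] [MetricSpace M] [MulAction T M] [IsIsometricSMul T M]
    {r : ℝ} (S : Set (PointSet M r)) : Set (PointSet M r) :=
  closure {Q | ∃ (x : T), ∃ P ∈ S, Q = x • P}

/-- All coloured point sets `P^(ω)` with `P` in the closed `T`-orbit of `S`. -/
def colouredHull (T : Type*) {M : Type*} (A : Type*) [Group T] [MetricSpace M] [MulAction T M]
    [IsIsometricSMul T M] {r : ℝ} (S : Set (PointSet M r)) : Set (ColouredPointSet M A r) :=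
  {Q | ∃ P ∈ hull T S, ∃ ω : P.1 → A, Q = colour P ω}

/-- A Følner sequence in the group `T`, with respect to the Haar measure `vol`: an increasing
sequence of non-empty compact sets, whose interiors exhaust `T`, such that for every non-empty
compact `K` the symmetric difference of `D n` and `K * D n` is of asymptotically negligible
volume relative to `D n`. -/
structure IsFolnerSequence {T : Type*} [Group T] [TopologicalSpace T] [MeasurableSpace T]
    (vol : Measure T) (D : ℕ → Set T) : Prop where
  monotone : Monotone D
  nonempty : ∀ n, (D n).Nonempty
  isCompact : ∀ n, IsCompact (D n)
  iUnion_interior : ⋃ n, interior (D n) = Set.univ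
  tendsto : ∀ K : Set T, IsCompact K → K.Nonempty →
    Tendsto (fun n => vol (symmDiff (K * D n) (D n)) / vol (D n)) atTop (𝓝 0)

/-- The local σ-algebra of events concerning only the colours of the points in `P ∩ V`: the
smallest σ-algebra making the restriction of colourings from `P` to `P ∩ V` measurable. -/
@[reducible] def localSigmaAlgebra {M : Type*} (A : Type*) [MeasurableSpace A] (P V : Set M) :
    MeasurableSpace (P → A) :=
  MeasurableSpace.comap
    (fun (ω : P → A) (q : (P ∩ V : Set M)) => ω ⟨q, q.2.1⟩) MeasurableSpace.pi

/-- Independence at a distance of a law `μ` of colourings of `P`: for some `ϱ > 0`, the local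
σ-algebras of any two regions with distance larger than `ϱ` are independent. -/
def IndependentAtDistance {M A : Type*} [MetricSpace M] [MeasurableSpace A] {P : Set M}
    (μ : Measure (P → A)) : Prop :=
  ∃ ϱ : ℝ, 0 < ϱ ∧ ∀ V₁ V₂ : Set M,
    ENNReal.ofReal ϱ < (⨅ p ∈ V₁, ⨅ q ∈ V₂, edist p q) →
      Indep (localSigmaAlgebra A P V₁) (localSigmaAlgebra A P V₂) μ

/-- The average of `f(xQ)` over `x ∈ D`. -/
def groupAverage {T M A : Type*} [Group T] [MeasurableSpace T] [MetricSpace M] [MulAction T M]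
    [IsIsometricSMul T M] {r : ℝ} (vol : Measure T) (D : Set T)
    (f : ColouredPointSet M A r → ℝ) (Q : ColouredPointSet M A r) : ℝ :=
  (vol.real D)⁻¹ * ∫ x in D, f (x • Q) ∂vol

section Closedness

variable {M A : Type*}

theorem image_fst_colouredSet (P : Set M) (ω : P → A) : Prod.fst '' colouredSet P ω = P := by
  ext m
  constructor
  · rintro ⟨_, ⟨p, rfl⟩, rfl⟩
    exact p.2
  · exact fun hm => ⟨_, ⟨⟨m, hm⟩, rfl⟩, rfl⟩

theorem injOn_fst_colouredSet (P : Set M) (ω : P → A) :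
    Set.InjOn Prod.fst (colouredSet P ω) := by
  rintro _ ⟨p, rfl⟩ _ ⟨q, rfl⟩ h
  have : p = q := Subtype.ext h
  rw [this]

variable [MetricSpace M] {r : ℝ}

/-- The point set underlying a coloured point set. -/
def ColouredPointSet.forget (Q : ColouredPointSet M A r) : PointSet M r :=
  ⟨Prod.fst '' Q.1, by
    obtain ⟨P, ω, h⟩ := Q.2
    rw [h, image_fst_colouredSet]
    exact P.2⟩

theorem ColouredPointSet.continuous_forget [TopologicalSpace A] [CompactSpace A] [T2Space A] :
    Continuous (ColouredPointSet.forget : ColouredPointSet M A r → PointSet M r) := by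
  refine continuous_iInf_rng.2 fun φ => continuous_induced_rng.2 ?_
  let ψ : C_c(M × A, ℝ) :=
    { toFun := fun q => φ q.1
      continuous_toFun := φ.continuous.comp continuous_fst
      hasCompactSupport' := by
        refine HasCompactSupport.intro (φ.hasCompactSupport.prod isCompact_univ) ?_
        intro q hq
        by_contra h
        exact hq ⟨subset_tsupport _ h, trivial⟩ }
  have hψ : Continuous fun Q : ColouredPointSet M A r => ∑ᶠ q ∈ Q.1, ψ q :=
    continuous_iInf_dom (i := ψ) continuous_induced_dom
  refine hψ.congr fun Q => ?_
  obtain ⟨P, ω, h⟩ := Q.2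
  exact (finsum_mem_image (f := φ) (by rw [h]; exact injOn_fst_colouredSet P.1 ω)).symm

/-- For a compact colour space, the coloured closed orbit is closed, so that continuity on its
closure is the same as continuity on it. -/
theorem isClosed_colouredHull (T : Type*) [Group T] [MulAction T M] [IsIsometricSMul T M]
    [TopologicalSpace A] [CompactSpace A] [T2Space A] (S : Set (PointSet M r)) :
    IsClosed (colouredHull T A S) := by
  have h : colouredHull T A S = ColouredPointSet.forget ⁻¹' hull T S := by
    ext Q
    constructor
    · rintro ⟨P, hP, ω, rfl⟩
      have : (colour P ω).forget = P := Subtype.ext (image_fst_colouredSet P.1 ω)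
      rwa [Set.mem_preimage, this]
    · intro hQ
      obtain ⟨P, ω, hω⟩ := Q.2
      have : Q = colour P ω := Subtype.ext hω
      subst this
      have h2 : (colour P ω).forget = P := Subtype.ext (image_fst_colouredSet P.1 ω)
      rw [Set.mem_preimage, h2] at hQ
      exact ⟨P, hQ, ω, rfl⟩
  rw [h]
  exact isClosed_closure.preimage ColouredPointSet.continuous_forget

end Closedness

end

/-!
# A strong law of large numbers for randomly coloured point sets

The proof reduces the averages of `f (x • P^(ω))` to averages of a bounded field on the group with
dependence of short range, for which second moments suffice.

*Localisation.* The space of coloured point sets is compact in the vague topology, even if the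
colour space is not (`compactSpace_colouredPointSet`): an ultrafilter converges to the set of those
points all of whose neighbourhoods are met by almost all sets, points with colours escaping to
infinity being lost. Since vague convergence only sees compact parts of the coloured sets, a
continuous function on a closed, hence compact, set depends up to `ε` only on the part over some
ball `K` (`exists_radius_forall_abs_sub_le`). Replacing the colours of the points not moved into
`K` by a fixed colour thus yields a field `G x` which is uniformly `ε`-close to `f (x • P^(ω))` and
depends only on the colours in `x⁻¹ K`. By independence at a distance, `G x` and `G y` are
independent unless `y * x⁻¹` moves a point of `K` into a larger ball, that is, unless `y ∈ L x` for
a set `L`, which is compact since the action is proper. By right invariance, `L x` has the same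
volume as `L`.

*Second moments.* For such a field, the variance of the average over `D n` is at most a constant
times `1 / vol (D n)` (`integral_sq_setIntegral_le`), and `vol (D n)` tends to infinity, since
Haar measure of a non-compact group is infinite. Along the first indices at which the volume
reaches the powers `q ^ k` of some `q > 1`, the variances are summable, which gives almost sure
convergence. As the sets `D n` increase and the field is bounded, the averages between two such
indices differ from these by a multiple of `q - 1`; finally `q` tends to `1`
(`tendsto_div_zero_of_geometric`, `ae_tendsto_centred_average`).
-/

/-! ### Coloured point sets and the vague topology -/

section Vague

theorem tendsto_vagueTopology {X ι κ : Type*} [TopologicalSpace X] (F : ι → Set X) {l : Filter κ}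
    {u : κ → ι} {i : ι} :
    Tendsto u l (@nhds ι (vagueTopology F) i) ↔
      ∀ φ : C_c(X, ℝ), Tendsto (fun k => ∑ᶠ p ∈ F (u k), φ p) l (𝓝 (∑ᶠ p ∈ F i, φ p)) := by
  rw [vagueTopology, nhds_iInf, tendsto_iInf]
  refine forall_congr' fun φ => ?_
  rw [nhds_induced, tendsto_comap_iff]
  rfl

variable {M A : Type*} [MetricSpace M] {r : ℝ}

/-- In a coloured point set, at most one coloured point lies over each open ball of radius `r`. -/
theorem ColouredPointSet.subsingleton_inter_ball (Q : ColouredPointSet M A r) (m : M) :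
    (Q.1 ∩ Prod.fst ⁻¹' Metric.ball m r).Subsingleton := by
  obtain ⟨P, ω, h⟩ := Q.2
  rw [h]
  rintro z ⟨hz, hzm⟩ w ⟨hw, hwm⟩
  have hP := image_fst_colouredSet P.1 ω
  refine injOn_fst_colouredSet P.1 ω hz hw (P.2 m ⟨?_, hzm⟩ ⟨?_, hwm⟩)
  · rw [← hP]; exact ⟨z, hz, rfl⟩
  · rw [← hP]; exact ⟨w, hw, rfl⟩

/-- The sets meeting each cylinder over an open ball of radius `r` in at most one point are
coloured point sets. -/
theorem exists_eq_colouredSet (hr : 0 < r) {Q : Set (M × A)}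
    (h : ∀ m : M, (Q ∩ Prod.fst ⁻¹' Metric.ball m r).Subsingleton) :
    ∃ (P : PointSet M r) (ω : P.1 → A), Q = colouredSet P.1 ω := by
  have hP : IsUniformlyDiscrete r (Prod.fst '' Q) := by
    rintro m _ ⟨⟨z, hz, rfl⟩, hzm⟩ _ ⟨⟨w, hw, rfl⟩, hwm⟩
    rw [h m ⟨hz, hzm⟩ ⟨hw, hwm⟩]
  have hc : ∀ p : Prod.fst '' Q, ∃ a : A, ((p : M), a) ∈ Q := by
    rintro ⟨_, ⟨m, a⟩, hz, rfl⟩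
    exact ⟨a, hz⟩
  choose ω hω using hc
  refine ⟨⟨_, hP⟩, ω, Set.Subset.antisymm ?_ ?_⟩
  · rintro ⟨m, a⟩ hz
    refine ⟨⟨m, ⟨m, a⟩, hz, rfl⟩, ?_⟩
    exact h m ⟨hω _, Metric.mem_ball_self hr⟩ ⟨hz, Metric.mem_ball_self hr⟩
  · rintro _ ⟨p, rfl⟩
    exact hω p

theorem ColouredPointSet.finite_inter_preimage_fst (hr : 0 < r) (Q : ColouredPointSet M A r)
    {K : Set M} (hK : IsCompact K) : (Q.1 ∩ Prod.fst ⁻¹' K).Finite := by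
  obtain ⟨t, -, hfin, ht⟩ := hK.finite_cover_balls hr
  refine (hfin.biUnion fun m _ => (Q.subsingleton_inter_ball m).finite).subset ?_
  rintro z ⟨hz, hzK⟩
  obtain ⟨m, hm, hzm⟩ := Set.mem_iUnion₂.1 (ht hzK)
  exact Set.mem_iUnion₂.2 ⟨m, hm, hz, hzm⟩

theorem IsUniformlyDiscrete.finite_inter (hr : 0 < r) {P : Set M} (hP : IsUniformlyDiscrete r P)
    {K : Set M} (hK : IsCompact K) : (P ∩ K).Finite := by
  obtain ⟨t, -, hfin, ht⟩ := hK.finite_cover_balls hr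
  refine (hfin.biUnion fun m _ => (hP m).finite).subset ?_
  rintro z ⟨hz, hzK⟩
  obtain ⟨m, hm, hzm⟩ := Set.mem_iUnion₂.1 (ht hzK)
  exact Set.mem_iUnion₂.2 ⟨m, hm, hz, hzm⟩

theorem IsUniformlyDiscrete.countable [ProperSpace M] (hr : 0 < r) {P : Set M}
    (hP : IsUniformlyDiscrete r P) : P.Countable := by
  have h : P = ⋃ n : ℕ, P ∩ compactCovering M n := by
    rw [← Set.inter_iUnion, iUnion_compactCovering, Set.inter_univ]
  rw [h]
  exact Set.countable_iUnion fun n =>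
    (hP.finite_inter hr (isCompact_compactCovering M n)).countable

/-- If `Q` has a single point in a set containing the support of `φ`, the sum over `Q` is the value
of `φ` at this point. -/
theorem finsum_mem_eq_of_subsingleton {X : Type*} {Q B : Set X} (hQ : (Q ∩ B).Subsingleton)
    {φ : X → ℝ} (hφ : Function.support φ ⊆ B) {z : X} (hz : z ∈ Q) (hzB : z ∈ B) :
    ∑ᶠ p ∈ Q, φ p = φ z := by
  rw [finsum_mem_eq_sum_of_subset (t := {z}) φ]
  · simp
  · rintro w ⟨hw, hwφ⟩
    simpa using hQ ⟨hw, hφ hwφ⟩ ⟨hz, hzB⟩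
  · simpa using hz

/-- The limit of an ultrafilter of coloured point sets: the points all of whose neighbourhoods are
met by almost all of these sets. Points whose colours leave every compact set leave no trace. -/
def ultrafilterLimit [TopologicalSpace A] (U : Ultrafilter (ColouredPointSet M A r)) :
    Set (M × A) :=
  {z | ∀ V ∈ 𝓝 z, ∀ᶠ Q in (U : Filter (ColouredPointSet M A r)), (Q.1 ∩ V).Nonempty}

theorem subsingleton_ultrafilterLimit [TopologicalSpace A] [T2Space A]
    (U : Ultrafilter (ColouredPointSet M A r)) (m : M) :
    (ultrafilterLimit U ∩ Prod.fst ⁻¹' Metric.ball m r).Subsingleton := by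
  rintro z ⟨hz, hzm⟩ w ⟨hw, hwm⟩
  by_contra hne
  obtain ⟨V, W, hV, hW, hzV, hwW, hd⟩ := t2_separation hne
  have hB : IsOpen (Prod.fst ⁻¹' Metric.ball m r : Set (M × A)) :=
    Metric.isOpen_ball.preimage continuous_fst
  obtain ⟨Q, ⟨p, hpQ, hpV, hpm⟩, ⟨q, hqQ, hqW, hqm⟩⟩ :=
    ((hz _ ((hV.inter hB).mem_nhds ⟨hzV, hzm⟩)).and
      (hw _ ((hW.inter hB).mem_nhds ⟨hwW, hwm⟩))).exists
  have : p = q := Q.subsingleton_inter_ball m ⟨hpQ, hpm⟩ ⟨hqQ, hqm⟩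
  subst this
  exact Set.disjoint_left.1 hd hpV hqW

/-- Convergence of the vague sums along an ultrafilter for test functions supported over a ball of
radius `r`: there each coloured point set has at most one point. -/
theorem tendsto_finsum_ultrafilterLimit_of_tsupport_subset [TopologicalSpace A] [T2Space A]
    (U : Ultrafilter (ColouredPointSet M A r)) (φ : C_c(M × A, ℝ)) (m : M)
    (hφ : tsupport φ ⊆ Prod.fst ⁻¹' Metric.ball m r) :
    Tendsto (fun Q : ColouredPointSet M A r => ∑ᶠ p ∈ Q.1, φ p) U
      (𝓝 (∑ᶠ p ∈ ultrafilterLimit U, φ p)) := by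
  have hB : IsOpen (Prod.fst ⁻¹' Metric.ball m r : Set (M × A)) :=
    Metric.isOpen_ball.preimage continuous_fst
  have hsupp : Function.support φ ⊆ Prod.fst ⁻¹' Metric.ball m r :=
    (subset_tsupport φ).trans hφ
  by_cases hex : ∃ z ∈ ultrafilterLimit U, z.1 ∈ Metric.ball m r
  · obtain ⟨z, hz, hzm⟩ := hex
    rw [finsum_mem_eq_of_subsingleton (subsingleton_ultrafilterLimit U m) hsupp hz hzm]
    intro V hV
    have hW : φ ⁻¹' V ∩ Prod.fst ⁻¹' Metric.ball m r ∈ 𝓝 z :=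
      inter_mem (φ.continuous.continuousAt.preimage_mem_nhds hV) (hB.mem_nhds hzm)
    rw [mem_map]
    filter_upwards [hz _ hW] with Q hQ
    obtain ⟨w, hwQ, hwV, hwm⟩ := hQ
    rw [Set.mem_preimage,
      finsum_mem_eq_of_subsingleton (Q.subsingleton_inter_ball m) hsupp hwQ hwm]
    exact hwV
  · have h0 : ∑ᶠ p ∈ ultrafilterLimit U, φ p = 0 := by
      refine finsum_mem_eq_zero_of_forall_eq_zero fun z hz => ?_
      by_contra hne
      exact hex ⟨z, hz, hsupp hne⟩
    rw [h0]
    refine Tendsto.congr' (f₁ := fun _ => 0) ?_ tendsto_const_nhds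
    by_contra hcon
    -- Otherwise the points carrying the sums stay in the compact support and accumulate there.
    have hev : ∀ᶠ Q in (U : Filter (ColouredPointSet M A r)), ∃ w ∈ Q.1, φ w ≠ 0 := by
      filter_upwards [Ultrafilter.eventually_not.2 hcon] with Q hQ
      by_contra! hall
      exact hQ (finsum_mem_eq_zero_of_forall_eq_zero hall).symm
    obtain ⟨Q₀, w₀, -⟩ := hev.exists
    classical
    let q : ColouredPointSet M A r → M × A := fun Q =>
      if h : ∃ w ∈ Q.1, φ w ≠ 0 then h.choose else w₀
    have hq : ∀ᶠ Q in (U : Filter (ColouredPointSet M A r)), q Q ∈ Q.1 ∧ φ (q Q) ≠ 0 := by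
      filter_upwards [hev] with Q hQ
      simp only [q, dif_pos hQ]
      exact hQ.choose_spec
    obtain ⟨z, hz, hle⟩ := isCompact_iff_ultrafilter_le_nhds.1 φ.hasCompactSupport.isCompact
      (U.map q) (le_principal_iff.2 (hq.mono fun Q h => subset_tsupport φ h.2))
    refine hex ⟨z, fun V hV => ?_, hφ hz⟩
    have hqV : ∀ᶠ Q in (U : Filter (ColouredPointSet M A r)), q Q ∈ V := hle hV
    filter_upwards [hq, hqV] with Q h1 h2
    exact ⟨q Q, h1.1, h2⟩

/-- Multiplication of a compactly supported test function on `M × A` with a function on `M`. -/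
def cutoff [TopologicalSpace A] (ρ : C(M, ℝ)) (φ : C_c(M × A, ℝ)) : C_c(M × A, ℝ) where
  toFun z := ρ z.1 * φ z
  continuous_toFun := (ρ.continuous.comp continuous_fst).mul φ.continuous
  hasCompactSupport' := φ.hasCompactSupport.mul_left

/-- A test function is a finite sum of test functions supported over balls of radius `r`. -/
theorem exists_sum_cutoff_eq [ProperSpace M] [TopologicalSpace A] (hr : 0 < r)
    (φ : C_c(M × A, ℝ)) : ∃ (n : ℕ) (m : Fin n → M) (ρ : Fin n → C(M, ℝ)),
      (∀ i, tsupport (cutoff (ρ i) φ) ⊆ Prod.fst ⁻¹' Metric.ball (m i) r) ∧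
      ∀ z, φ z = ∑ i, cutoff (ρ i) φ z := by
  have hK : IsCompact (Prod.fst '' tsupport φ) := φ.hasCompactSupport.isCompact.image continuous_fst
  obtain ⟨t, -, hfin, ht⟩ := hK.finite_cover_balls hr
  obtain ⟨n, m, hm⟩ : ∃ (n : ℕ) (m : Fin n → M), Set.range m = t :=
    ⟨_, _, (by rw [Set.range_comp, Equiv.range_eq_univ, Set.image_univ, Subtype.range_coe,
      Set.Finite.coe_toFinset] : Set.range
        ((Subtype.val : hfin.toFinset → M) ∘ hfin.toFinset.equivFin.symm) = t)⟩
  obtain ⟨ρ, hρ, hone, -, -⟩ := exists_continuous_sum_one_of_isOpen_isCompact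
    (s := fun i => Metric.ball (m i) r) (fun i => Metric.isOpen_ball) hK (by
      rw [← hm, Set.biUnion_range] at ht
      exact ht)
  refine ⟨n, m, ρ, fun i => ?_, fun z => ?_⟩
  · have h1 : tsupport (cutoff (ρ i) φ) ⊆ tsupport fun z : M × A => ρ i z.1 :=
      tsupport_mul_subset_left
    exact (h1.trans (tsupport_comp_subset_preimage (ρ i) continuous_fst)).trans
      (Set.preimage_mono (hρ i))
  · change φ z = ∑ i, ρ i z.1 * φ z
    rw [← Finset.sum_mul]
    by_cases hz : φ z = 0
    · rw [hz, mul_zero]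
    · have := hone (x := z.1) ⟨z, subset_tsupport φ hz, rfl⟩
      rw [Finset.sum_apply, Pi.one_apply] at this
      rw [this, one_mul]

theorem ColouredPointSet.finsum_mem_sum [TopologicalSpace A] (hr : 0 < r)
    (Q : ColouredPointSet M A r) {n : ℕ} (φ : Fin n → C_c(M × A, ℝ)) :
    ∑ᶠ p ∈ Q.1, ∑ i, φ i p = ∑ i, ∑ᶠ p ∈ Q.1, φ i p := by
  have hK : IsCompact (⋃ i, Prod.fst '' tsupport (φ i)) :=
    isCompact_iUnion fun i => (φ i).hasCompactSupport.isCompact.image continuous_fst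
  have hfin := Q.finite_inter_preimage_fst hr hK
  have hmem : ∀ i z, φ i z ≠ 0 → z.1 ∈ ⋃ i, Prod.fst '' tsupport (φ i) := fun i z h =>
    Set.mem_iUnion.2 ⟨i, z, subset_tsupport _ h, rfl⟩
  have h1 : ∀ i, ∑ᶠ p ∈ Q.1, φ i p = ∑ p ∈ hfin.toFinset, φ i p := fun i =>
    finsum_mem_eq_sum_of_subset _ (fun z hz => by
      rw [Set.Finite.coe_toFinset]; exact ⟨hz.1, hmem i z hz.2⟩) (by simp)
  simp_rw [h1]
  rw [Finset.sum_comm]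
  refine finsum_mem_eq_sum_of_subset _ (fun z hz => ?_) (by simp)
  obtain ⟨i, -, hi⟩ := Finset.exists_ne_zero_of_sum_ne_zero hz.2
  rw [Set.Finite.coe_toFinset]
  exact ⟨hz.1, hmem i z hi⟩

/-- The space of coloured point sets is compact, even if the colour space is not: every
ultrafilter converges to its limit set. -/
theorem compactSpace_colouredPointSet [ProperSpace M] [TopologicalSpace A] [T2Space A]
    (hr : 0 < r) : CompactSpace (ColouredPointSet M A r) := by
  refine ⟨isCompact_iff_ultrafilter_le_nhds.2 fun U _ => ?_⟩
  let L : ColouredPointSet M A r :=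
    ⟨ultrafilterLimit U, exists_eq_colouredSet hr (subsingleton_ultrafilterLimit U)⟩
  refine ⟨L, trivial, ?_⟩
  refine (tendsto_vagueTopology (fun Q : ColouredPointSet M A r => Q.1) (u := id)).2 fun φ => ?_
  obtain ⟨n, m, ρ, hρ, hsum⟩ := exists_sum_cutoff_eq hr φ
  simp_rw [hsum, ColouredPointSet.finsum_mem_sum hr]
  exact tendsto_finsetSum _ fun i _ =>
    tendsto_finsum_ultrafilterLimit_of_tsupport_subset U (cutoff (ρ i) φ) (m i) (hρ i)

/-- A continuous function on a closed set of coloured point sets is approximately local: up to `ε`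
it depends only on the coloured points over a sufficiently large ball. -/
theorem exists_radius_forall_abs_sub_le [ProperSpace M] [TopologicalSpace A] [T2Space A]
    (hr : 0 < r) {C : Set (ColouredPointSet M A r)} (hC : IsClosed C)
    {f : ColouredPointSet M A r → ℝ} (hf : ContinuousOn f C) (o : M) {ε : ℝ} (hε : 0 < ε) :
    ∃ R : ℝ, ∀ Q ∈ C, ∀ Q' ∈ C,
      Q.1 ∩ Prod.fst ⁻¹' Metric.closedBall o R = Q'.1 ∩ Prod.fst ⁻¹' Metric.closedBall o R →
        |f Q - f Q'| ≤ ε := by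
  have := compactSpace_colouredPointSet (A := A) (M := M) hr
  by_contra! hcon
  choose Q hQ Q' hQ' heq hlt using fun n : ℕ => hcon n
  let U : Ultrafilter ℕ := hyperfilter ℕ
  have hU : (U : Filter ℕ) ≤ atTop := Nat.hyperfilter_le_atTop
  obtain ⟨z, hz, hle⟩ := isCompact_iff_ultrafilter_le_nhds.1 hC.isCompact (U.map Q)
    (le_principal_iff.2 (Eventually.of_forall hQ : ∀ᶠ n in (U : Filter ℕ), Q n ∈ C))
  have h1 : Tendsto Q U (𝓝 z) := hle
  have h2 : Tendsto Q' U (𝓝 z) := by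
    refine (tendsto_vagueTopology _).2 fun φ => ?_
    refine ((tendsto_vagueTopology _).1 h1 φ).congr' ?_
    have hK := φ.hasCompactSupport.isCompact.image continuous_fst
    obtain ⟨R, hR⟩ := hK.isBounded.subset_closedBall o
    refine hU ((eventually_ge_atTop ⌈R⌉₊).mono fun n hn => ?_)
    have hRn : R ≤ n := (Nat.le_ceil R).trans (by exact_mod_cast hn)
    have hsupp : ∀ p, φ p ≠ 0 → p ∈ Prod.fst ⁻¹' Metric.closedBall o (n : ℝ) := fun p hp =>
      Metric.closedBall_subset_closedBall hRn (hR ⟨p, subset_tsupport φ hp, rfl⟩)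
    have hmem : ∀ p, p ∈ Function.support φ → (p ∈ (Q n).1 ↔ p ∈ (Q' n).1) := fun p hp => by
      have h := Set.ext_iff.1 (heq n) p
      simpa only [Set.mem_inter_iff, hsupp p hp, and_true] using h
    exact finsum_mem_inter_support_eq' _ _ _ hmem
  have h3 : Tendsto (fun n => f (Q n)) U (𝓝 (f z)) := (hf z hz).tendsto.comp
    (tendsto_nhdsWithin_iff.2 ⟨h1, Eventually.of_forall hQ⟩)
  have h4 : Tendsto (fun n => f (Q' n)) U (𝓝 (f z)) := (hf z hz).tendsto.comp
    (tendsto_nhdsWithin_iff.2 ⟨h2, Eventually.of_forall hQ'⟩)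
  have h5 := (h3.sub h4).abs
  rw [sub_self, abs_zero] at h5
  obtain ⟨n, hn⟩ := (h5.eventually (gt_mem_nhds hε)).exists
  exact (hlt n).not_gt hn

end Vague

/-! ### The group action -/

section GroupAction

variable {T M A : Type*} [Group T] [MetricSpace M] [MulAction T M] [IsIsometricSMul T M] {r : ℝ}

theorem smul_colour (x : T) (P : PointSet M r) (ω : P.1 → A) :
    x • colour P ω = colour (x • P) (shiftColouring x P ω) :=
  Subtype.ext (image_colouredSet x P ω)

theorem val_smul_colour (x : T) (P : PointSet M r) (ω : P.1 → A) :
    (x • colour P ω).1 = Set.range fun p : P.1 => (x • (p : M), ω p) := by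
  change (fun q : M × A => (x • q.1, q.2)) '' Set.range (fun p : P.1 => ((p : M), ω p)) = _
  rw [← Set.range_comp]
  rfl

theorem continuous_smul_pointSet (x : T) : Continuous fun P : PointSet M r => x • P := by
  have hx : Continuous fun m : M => x • m := (isometry_smul M x).continuous
  refine continuous_iff_continuousAt.2 fun P => (tendsto_vagueTopology _).2 fun φ => ?_
  let ψ : C_c(M, ℝ) :=
    { toFun := fun m => φ (x • m)
      continuous_toFun := φ.continuous.comp hx
      hasCompactSupport' :=
        φ.hasCompactSupport.comp_homeomorph (IsometryEquiv.constSMul x).toHomeomorph }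
  have h : ∀ P : PointSet M r, ∑ᶠ q ∈ (x • P).1, φ q = ∑ᶠ q ∈ P.1, ψ q := fun P =>
    finsum_mem_image (MulAction.injective x).injOn
  simp_rw [h]
  exact (tendsto_vagueTopology _).1 (continuousAt_id (x := P)) ψ

theorem smul_mem_hull {S : Set (PointSet M r)} {P : PointSet M r} (hP : P ∈ hull T S) (x : T) :
    x • P ∈ hull T S := by
  refine map_mem_closure (continuous_smul_pointSet x) hP ?_
  rintro _ ⟨y, Q, hQ, rfl⟩
  exact ⟨x * y, Q, hQ, Subtype.ext (smul_smul x y Q.1)⟩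

theorem smul_colour_mem_colouredHull {S : Set (PointSet M r)} {P : PointSet M r}
    (hP : P ∈ hull T S) (x : T) (ω : P.1 → A) : x • colour P ω ∈ colouredHull T A S :=
  ⟨x • P, smul_mem_hull hP x, _, smul_colour x P ω⟩

/-- The translates of `P^(ω)` depend continuously on the group element and on the colouring, since
only finitely many points of `P` are moved into a given compact set by a neighbourhood of `x`. -/
theorem continuous_smul_colour [TopologicalSpace T] [IsTopologicalGroup T]
    [WeaklyLocallyCompactSpace T] [ContinuousSMul T M] [TopologicalSpace A] (hr : 0 < r)
    (P : PointSet M r) : Continuous fun z : T × (P.1 → A) => z.1 • colour P z.2 := by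
  refine continuous_iff_continuousAt.2 fun z₀ => (tendsto_vagueTopology _).2 fun φ => ?_
  have hsum : ∀ z : T × (P.1 → A), ∑ᶠ q ∈ (z.1 • colour P z.2).1, φ q =
      ∑ᶠ p : P.1, φ (z.1 • (p : M), z.2 p) := fun z => by
    rw [val_smul_colour]
    refine finsum_mem_range fun p q h => ?_
    exact Subtype.ext (MulAction.injective z.1 (Prod.mk.inj h).1)
  simp_rw [hsum]
  refine Continuous.continuousAt (continuous_finsum (fun p => ?_) fun z => ?_)
  · fun_prop
  · obtain ⟨C, hC, hCz⟩ := exists_compact_mem_nhds z.1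
    have hK := φ.hasCompactSupport.isCompact.image continuous_fst
    have hfin := P.2.finite_inter hr (hC.inv.smul_set hK)
    refine ⟨C ×ˢ Set.univ, prod_mem_nhds hCz univ_mem, ?_⟩
    refine (hfin.preimage Subtype.val_injective.injOn).subset ?_
    rintro p ⟨w, hw, hwC, -⟩
    refine ⟨p.2, Set.mem_smul.2 ⟨w.1⁻¹, Set.inv_mem_inv.2 hwC, w.1 • (p : M),
      ⟨_, subset_tsupport φ hw, rfl⟩, inv_smul_smul _ _⟩⟩

end GroupAction

/-! ### A law of large numbers for bounded fields with short-range dependence -/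

section LawOfLargeNumbers

/-- Almost sure convergence to zero of a sequence with summable second moments. -/
theorem ae_tendsto_zero_of_sum_sq {Ω : Type*} {mΩ : MeasurableSpace Ω} {μ : Measure Ω}
    {Z : ℕ → Ω → ℝ} (hZ : ∀ n, Measurable (Z n)) (hint : ∀ n, Integrable (fun ω => Z n ω ^ 2) μ)
    {b : ℕ → ℝ} (hb : Summable b) (hle : ∀ n, ∫ ω, Z n ω ^ 2 ∂μ ≤ b n) :
    ∀ᵐ ω ∂μ, Tendsto (fun n => Z n ω) atTop (𝓝 0) := by
  have hb0 : ∀ n, 0 ≤ b n := fun n => (integral_nonneg fun ω => sq_nonneg _).trans (hle n)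
  have hfin : ∫⁻ ω, ∑' n, ENNReal.ofReal (Z n ω ^ 2) ∂μ ≠ ⊤ := by
    rw [lintegral_tsum fun n => ((hZ n).pow_const 2).ennreal_ofReal.aemeasurable]
    refine ne_top_of_le_ne_top (hb.tsum_ofReal_ne_top) (ENNReal.tsum_le_tsum fun n => ?_)
    rw [← ofReal_integral_eq_lintegral_ofReal (hint n)
      (Eventually.of_forall fun ω => sq_nonneg _)]
    exact ENNReal.ofReal_le_ofReal (hle n)
  have hmeas : Measurable fun ω => ∑' n, ENNReal.ofReal (Z n ω ^ 2) :=
    Measurable.tsum fun n => ((hZ n).pow_const 2).ennreal_ofReal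
  filter_upwards [ae_lt_top hmeas hfin] with ω hω
  have h1 := ENNReal.tendsto_atTop_zero_of_tsum_ne_top hω.ne
  have h2 : Tendsto (fun n => Z n ω ^ 2) atTop (𝓝 0) := by
    have h := (ENNReal.tendsto_toReal ENNReal.zero_ne_top).comp h1
    refine h.congr fun n => ?_
    simp only [Function.comp_apply]
    exact ENNReal.toReal_ofReal (sq_nonneg _)
  have h3 := (Real.continuous_sqrt.tendsto 0).comp h2
  rw [Real.sqrt_zero] at h3
  refine (tendsto_zero_iff_abs_tendsto_zero _).2 (h3.congr fun n => ?_)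
  exact Real.sqrt_sq_eq_abs _

/-- Let `s n` be sums with increments controlled by those of the volumes `v n`. If the averages
`s n / v n` vanish along the first indices at which the volume reaches the powers of `q j`, for
ratios `q j > 1` tending to `1`, they vanish along the whole sequence: between two such indices
the average is at most its absolute value at the first of them plus `C * (q j - 1)`. -/
theorem tendsto_div_zero_of_geometric {v s : ℕ → ℝ} {C : ℝ} (hC : 0 ≤ C)
    (hv : Tendsto v atTop atTop) (hmono : Monotone v)
    (hs : ∀ m n, m ≤ n → |s n - s m| ≤ C * (v n - v m))
    (N : ℕ → ℕ → ℕ) {q : ℕ → ℝ} (hq1 : ∀ j, 1 < q j) (hq : Tendsto q atTop (𝓝 1))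
    (hN : ∀ j k, q j ^ k ≤ v (N j k)) (hNmin : ∀ j k n, q j ^ k ≤ v n → N j k ≤ n)
    (hlim : ∀ j, Tendsto (fun k => s (N j k) / v (N j k)) atTop (𝓝 0)) :
    Tendsto (fun n => s n / v n) atTop (𝓝 0) := by
  rw [Metric.tendsto_atTop]
  intro ε hε
  obtain ⟨j, hj⟩ : ∃ j, C * (q j - 1) < ε / 2 := by
    have h : Tendsto (fun j => C * (q j - 1)) atTop (𝓝 (C * (1 - 1))) :=
      (hq.sub_const 1).const_mul C
    rw [sub_self, mul_zero] at h
    exact (h.eventually (gt_mem_nhds (half_pos hε))).exists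
  obtain ⟨k₀, hk₀⟩ := Metric.tendsto_atTop.1 (hlim j) (ε / 2) (half_pos hε)
  obtain ⟨n₀, hn₀⟩ := eventually_atTop.1 (hv.eventually_ge_atTop (q j ^ k₀))
  refine ⟨n₀, fun n hn => ?_⟩
  have hqpos : 0 < q j := zero_lt_one.trans (hq1 j)
  have hvn : q j ^ k₀ ≤ v n := hn₀ n hn
  have h1 : 1 ≤ v n := (one_le_pow₀ (hq1 j).le).trans hvn
  obtain ⟨k, hk, hk'⟩ := exists_nat_pow_near h1 (hq1 j)
  have hkk : k₀ ≤ k := Nat.lt_succ_iff.1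
    ((pow_lt_pow_iff_right₀ (hq1 j)).1 (hvn.trans_lt hk'))
  have hle := hNmin j k n hk
  have hinc := hs _ _ hle
  have hNk := hN j k
  have hsmall := hk₀ k hkk
  rw [Real.dist_eq, sub_zero] at hsmall ⊢
  have hv1 : 1 ≤ v (N j k) := (one_le_pow₀ (hq1 j).le).trans hNk
  have hvpos : 0 < v (N j k) := zero_lt_one.trans_le hv1
  have hratio : v n ≤ q j * v (N j k) := by
    rw [pow_succ'] at hk'
    exact hk'.le.trans (mul_le_mul_of_nonneg_left hNk hqpos.le)
  have hvmono : v (N j k) ≤ v n := hmono hle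
  rw [abs_div, abs_of_pos (zero_lt_one.trans_le h1), div_lt_iff₀ (zero_lt_one.trans_le h1)]
  rw [abs_div, abs_of_pos hvpos, div_lt_iff₀ hvpos] at hsmall
  have htri : |s n| ≤ |s n - s (N j k)| + |s (N j k)| := by
    simpa using abs_add_le (s n - s (N j k)) (s (N j k))
  have h2 : C * (v n - v (N j k)) ≤ C * (q j - 1) * v (N j k) := by
    rw [mul_assoc]
    exact mul_le_mul_of_nonneg_left (by linarith) hC
  have h3 : C * (q j - 1) * v (N j k) ≤ ε / 2 * v (N j k) :=
    mul_le_mul_of_nonneg_right hj.le hvpos.le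
  nlinarith

variable {T Ω : Type*} {mT : MeasurableSpace T} {mΩ : MeasurableSpace Ω} {vol : Measure T}
  {μ : Measure Ω}

/-- The second moment of the integral of a bounded field over a region is at most of the order of
the volume of this region if values at `x` and `y` are uncorrelated for `y` outside a set `B x`
of bounded volume. -/
theorem integral_sq_setIntegral_le [SFinite vol] [IsProbabilityMeasure μ] {H : T → Ω → ℝ}
    (hH : Measurable (Function.uncurry H)) {C b : ℝ} (hHC : ∀ x ω, |H x ω| ≤ C) {B : T → Set T}
    (hB : ∀ x, MeasurableSet (B x)) (hBfin : ∀ x, vol (B x) ≠ ⊤) (hBb : ∀ x, vol.real (B x) ≤ b)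
    (hcov : ∀ x, ∀ y ∉ B x, ∫ ω, H x ω * H y ω ∂μ = 0) {D : Set T} (hD : vol D ≠ ⊤) :
    ∫ ω, (∫ x in D, H x ω ∂vol) ^ 2 ∂μ ≤ C ^ 2 * b * vol.real D := by
  have : IsFiniteMeasure (vol.restrict D) := isFiniteMeasure_restrict.2 hD
  have hmul : Measurable fun z : Ω × (T × T) => H z.2.1 z.1 * H z.2.2 z.1 :=
    (hH.comp (by fun_prop : Measurable fun z : Ω × (T × T) => (z.2.1, z.1))).mul
      (hH.comp (by fun_prop : Measurable fun z : Ω × (T × T) => (z.2.2, z.1)))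
  have hbd : ∀ x y ω, |H x ω * H y ω| ≤ C ^ 2 := fun x y ω => by
    rw [abs_mul, sq]
    exact mul_le_mul (hHC x ω) (hHC y ω) (abs_nonneg _) ((abs_nonneg _).trans (hHC x ω))
  have hint : Integrable (fun z : Ω × (T × T) => H z.2.1 z.1 * H z.2.2 z.1)
      (μ.prod ((vol.restrict D).prod (vol.restrict D))) :=
    Integrable.of_bound hmul.aestronglyMeasurable (C ^ 2)
      (Eventually.of_forall fun z => hbd _ _ _)
  have hswap : ∫ ω, (∫ x in D, H x ω ∂vol) ^ 2 ∂μ =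
      ∫ x in D, ∫ y in D, ∫ ω, H x ω * H y ω ∂μ ∂vol ∂vol := by
    have h1 : ∀ ω, (∫ x in D, H x ω ∂vol) ^ 2 =
        ∫ z, H z.1 ω * H z.2 ω ∂(vol.restrict D).prod (vol.restrict D) := fun ω => by
      rw [integral_prod_mul (fun x => H x ω) fun x => H x ω, sq]
    simp_rw [h1]
    rw [integral_integral_swap hint, integral_prod _ hint.integral_prod_right]
  have hcovle : ∀ x y, ∫ ω, H x ω * H y ω ∂μ ≤ (B x).indicator (fun _ => C ^ 2) y := fun x y => by
    by_cases hy : y ∈ B x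
    · rw [Set.indicator_of_mem hy]
      refine (le_abs_self _).trans ?_
      have h := norm_integral_le_of_norm_le_const (μ := μ) (C := C ^ 2)
        (f := fun ω => H x ω * H y ω) (Eventually.of_forall fun ω => hbd x y ω)
      simpa using h
    · rw [Set.indicator_of_notMem hy, hcov x y hy]
  have hinner : ∀ x, ∫ y in D, ∫ ω, H x ω * H y ω ∂μ ∂vol ≤ C ^ 2 * b := fun x => by
    have h1 : Integrable ((B x).indicator fun _ => C ^ 2) (vol.restrict D) :=
      (integrable_const _).indicator (hB x)
    have hmx : Measurable fun z : T × Ω => H x z.2 * H z.1 z.2 :=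
      (hH.comp (by fun_prop : Measurable fun z : T × Ω => (x, z.2))).mul hH
    have h0 : Integrable (fun y => ∫ ω, H x ω * H y ω ∂μ) (vol.restrict D) := by
      refine Integrable.of_bound
        hmx.stronglyMeasurable.integral_prod_right.aestronglyMeasurable (C ^ 2)
        (Eventually.of_forall fun y => ?_)
      have h := norm_integral_le_of_norm_le_const (μ := μ) (C := C ^ 2)
        (f := fun ω => H x ω * H y ω) (Eventually.of_forall fun ω => hbd x y ω)
      simpa using h
    refine (integral_mono h0 h1 (hcovle x)).trans ?_
    rw [integral_indicator_const _ (hB x), smul_eq_mul, mul_comm]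
    refine mul_le_mul_of_nonneg_left (le_trans ?_ (hBb x)) (sq_nonneg _)
    exact ENNReal.toReal_mono (hBfin x) (Measure.restrict_apply_le _ _)
  rw [hswap]
  have h2 : Integrable (fun x => ∫ y in D, ∫ ω, H x ω * H y ω ∂μ ∂vol) (vol.restrict D) := by
    have h := hint.integral_prod_right.integral_prod_left
    exact h
  refine (integral_mono h2 (integrable_const _) hinner).trans ?_
  simp [mul_comm, measureReal_def]

/-- Strong law of large numbers for a bounded measurable field `G` indexed by a measure space:
the centred averages over an increasing sequence of sets with volumes tending to infinity vanish
almost surely, provided that `G x` and `G y` are independent for `y` outside a set `B x` of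
bounded volume. -/
theorem ae_tendsto_centred_average [SFinite vol] [IsProbabilityMeasure μ] {G : T → Ω → ℝ}
    (hG : Measurable (Function.uncurry G)) {C b : ℝ} (hGC : ∀ x ω, |G x ω| ≤ C) {B : T → Set T}
    (hB : ∀ x, MeasurableSet (B x)) (hBfin : ∀ x, vol (B x) ≠ ⊤) (hBb : ∀ x, vol.real (B x) ≤ b)
    (hind : ∀ x, ∀ y ∉ B x, IndepFun (G x) (G y) μ) {D : ℕ → Set T} (hDmono : Monotone D)
    (hDmeas : ∀ n, MeasurableSet (D n)) (hDfin : ∀ n, vol (D n) ≠ ⊤)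
    (hDtop : Tendsto (fun n => vol.real (D n)) atTop atTop) :
    ∀ᵐ ω ∂μ, Tendsto (fun n => (vol.real (D n))⁻¹ * ∫ x in D n, G x ω ∂vol -
      ∫ η, (vol.real (D n))⁻¹ * ∫ x in D n, G x η ∂vol ∂μ) atTop (𝓝 0) := by
  have hfinD : ∀ n, IsFiniteMeasure (vol.restrict (D n)) := fun n =>
    isFiniteMeasure_restrict.2 (hDfin n)
  have hGx : ∀ x, Measurable (G x) := fun x => hG.comp measurable_prodMk_left
  have hGint : ∀ x, Integrable (G x) μ := fun x =>
    Integrable.of_bound (hGx x).aestronglyMeasurable C (Eventually.of_forall (hGC x))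
  have hEmeas : Measurable fun x => ∫ η, G x η ∂μ :=
    hG.stronglyMeasurable.integral_prod_right.measurable
  have hEC : ∀ x, |∫ η, G x η ∂μ| ≤ C := fun x => by
    simpa using norm_integral_le_of_norm_le_const (μ := μ) (f := G x) (Eventually.of_forall (hGC x))
  -- The centred field `H`.
  let H : T → Ω → ℝ := fun x ω => G x ω - ∫ η, G x η ∂μ
  have hH : Measurable (Function.uncurry H) := hG.sub (hEmeas.comp measurable_fst)
  have hHC : ∀ x ω, |H x ω| ≤ 2 * C := fun x ω => by
    have h := abs_sub (G x ω) (∫ η, G x η ∂μ)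
    have h1 := hGC x ω
    have h2 := hEC x
    change |G x ω - ∫ η, G x η ∂μ| ≤ 2 * C
    linarith
  have hcov : ∀ x, ∀ y ∉ B x, ∫ ω, H x ω * H y ω ∂μ = 0 := fun x y hy => by
    have h1 : IndepFun (H x) (H y) μ :=
      (hind x y hy).comp (measurable_id.sub_const _) (measurable_id.sub_const _)
    have h2 := h1.integral_mul_eq_mul_integral
      ((hGx x).sub_const _).aestronglyMeasurable ((hGx y).sub_const _).aestronglyMeasurable
    have h3 : ∫ ω, H x ω ∂μ = 0 := by
      simp only [H]
      rw [integral_sub (hGint x) (integrable_const _)]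
      simp
    rw [h3, zero_mul] at h2
    exact h2
  have hHint : ∀ n ω, Integrable (fun x => H x ω) (vol.restrict (D n)) := fun n ω =>
    Integrable.of_bound (hH.comp measurable_prodMk_right).aestronglyMeasurable (2 * C)
      (Eventually.of_forall fun x => hHC x ω)
  have hSmeas : ∀ n, Measurable fun ω => ∫ x in D n, H x ω ∂vol := fun n =>
    hH.stronglyMeasurable.integral_prod_left.measurable
  have hSC : ∀ n ω, |∫ x in D n, H x ω ∂vol| ≤ 2 * C * vol.real (D n) := fun n ω => by
    have h := norm_integral_le_of_norm_le_const (μ := vol.restrict (D n))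
      (f := fun x => H x ω)
      (Eventually.of_forall fun x => hHC x ω)
    simpa [measureReal_def] using h
  -- The averages of the centred field are the centred averages.
  have hcentre : ∀ n ω, (vol.real (D n))⁻¹ * ∫ x in D n, G x ω ∂vol -
      ∫ η, (vol.real (D n))⁻¹ * ∫ x in D n, G x η ∂vol ∂μ =
      (∫ x in D n, H x ω ∂vol) / vol.real (D n) := fun n ω => by
    have hprod : Integrable (fun z : Ω × T => G z.2 z.1) (μ.prod (vol.restrict (D n))) :=
      Integrable.of_bound (hG.comp measurable_swap).aestronglyMeasurable C
        (Eventually.of_forall fun z => hGC _ _)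
    rw [integral_const_mul, integral_integral_swap hprod]
    have h1 : Integrable (fun x => G x ω) (vol.restrict (D n)) :=
      Integrable.of_bound (hG.comp measurable_prodMk_right).aestronglyMeasurable C
        (Eventually.of_forall fun x => hGC x ω)
    have h2 : Integrable (fun x => ∫ η, G x η ∂μ) (vol.restrict (D n)) :=
      Integrable.of_bound hEmeas.aestronglyMeasurable C (Eventually.of_forall hEC)
    simp only [H]
    rw [integral_sub h1 h2]
    ring
  simp_rw [hcentre]
  rcases isEmpty_or_nonempty T with hT | ⟨⟨x₀⟩⟩
  · refine Eventually.of_forall fun ω => ?_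
    simp [Measure.eq_zero_of_isEmpty vol]
  have hb : 0 ≤ b := measureReal_nonneg.trans (hBb x₀)
  have hΩ : Nonempty Ω := μ.nonempty_of_neZero
  have hC : 0 ≤ C := (abs_nonneg _).trans (hGC x₀ hΩ.some)
  -- Ratios `q j > 1` tending to `1`, and the first indices at which the volume reaches `q j ^ k`.
  let q : ℕ → ℝ := fun j => 1 + 1 / ((j : ℝ) + 1)
  have hq1 : ∀ j, 1 < q j := fun j => lt_add_of_pos_right _ Nat.one_div_pos_of_nat
  have hq : Tendsto q atTop (𝓝 1) := by
    simpa [q] using tendsto_one_div_add_atTop_nhds_zero_nat.const_add (1 : ℝ)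
  have hex : ∀ j k, ∃ n, q j ^ k ≤ vol.real (D n) := fun j k =>
    (hDtop.eventually_ge_atTop (q j ^ k)).exists
  classical
  let N : ℕ → ℕ → ℕ := fun j k => Nat.find (hex j k)
  have hN : ∀ j k, q j ^ k ≤ vol.real (D (N j k)) := fun j k => Nat.find_spec (hex j k)
  have hlim : ∀ j, ∀ᵐ ω ∂μ, Tendsto
      (fun k => (∫ x in D (N j k), H x ω ∂vol) / vol.real (D (N j k))) atTop (𝓝 0) := fun j => by
    have hqpos : 0 < q j := zero_lt_one.trans (hq1 j)
    refine ae_tendsto_zero_of_sum_sq (b := fun k => (2 * C) ^ 2 * b * (q j)⁻¹ ^ k)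
      (fun k => (hSmeas _).div_const _) (fun k => ?_)
      ((summable_geometric_of_lt_one (inv_nonneg.2 hqpos.le)
        (inv_lt_one_of_one_lt₀ (hq1 j))).mul_left _) fun k => ?_
    · refine Integrable.of_bound (((hSmeas _).div_const _).pow_const 2).aestronglyMeasurable
        ((2 * C) ^ 2) (Eventually.of_forall fun ω => ?_)
      have hvpos : 0 < vol.real (D (N j k)) := (pow_pos hqpos k).trans_le (hN j k)
      rw [norm_pow, Real.norm_eq_abs, abs_div, abs_of_pos hvpos]
      refine pow_le_pow_left₀ (by positivity) ((div_le_iff₀ hvpos).2 (hSC _ ω)) 2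
    · have hvpos : 0 < vol.real (D (N j k)) := (pow_pos hqpos k).trans_le (hN j k)
      simp_rw [div_pow]
      rw [integral_div, div_le_iff₀ (pow_pos hvpos 2)]
      refine (integral_sq_setIntegral_le hH hHC hB hBfin hBb hcov (hDfin _)).trans ?_
      rw [mul_assoc _ ((q j)⁻¹ ^ k)]
      refine mul_le_mul_of_nonneg_left ?_ (by positivity)
      rw [inv_pow, sq, ← mul_assoc]
      refine le_mul_of_one_le_left hvpos.le ?_
      rw [inv_mul_eq_div, one_le_div (pow_pos hqpos k)]
      exact hN j k
  filter_upwards [ae_all_iff.2 hlim] with ω hω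
  refine tendsto_div_zero_of_geometric (C := 2 * C) (by positivity) hDtop
    (fun m n hmn => measureReal_mono (hDmono hmn) (hDfin n)) (fun m n hmn => ?_) N
    hq1 hq hN (fun j k n h => Nat.find_min' (hex j k) h) hω
  rw [← setIntegral_sdiff (hDmeas m) (hHint n ω) (hDmono hmn)]
  have h := norm_setIntegral_le_of_norm_le_const (μ := vol) (s := D n \ D m) (C := 2 * C)
    (f := fun x => H x ω)
    ((measure_mono Set.sdiff_subset).trans_lt (hDfin n).lt_top) (fun x _ => hHC x ω)
  rwa [measureReal_sdiff (hDmono hmn) (hDmeas m) (hDfin n)] at h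

end LawOfLargeNumbers

/-! ### Localised fields -/

section Localisation

variable {M T A : Type*} [Group T] [MulAction T M]

open Classical in
/-- The colouring of `P` which agrees with `ω` at the points moved into `K` by `x`, all other points
receiving the colour `a`. The same index type `P` is kept, so that it colours `P` itself. -/
noncomputable def localColouring (P : Set M) (K : Set M) (a : A) (x : T) (ω : P → A) :
    P → A := fun p =>
  if x • (p : M) ∈ K then ω p else a

theorem smul_colour_localColouring_inter [MetricSpace M] [IsIsometricSMul T M] {r : ℝ}
    (P : PointSet M r) (K : Set M) (a : A) (x : T) (ω : P.1 → A) :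
    (x • colour P (localColouring P.1 K a x ω)).1 ∩ Prod.fst ⁻¹' K =
      (x • colour P ω).1 ∩ Prod.fst ⁻¹' K := by
  rw [val_smul_colour, val_smul_colour]
  ext z
  constructor <;>
  · rintro ⟨⟨p, rfl⟩, hp⟩
    have hp' : x • (p : M) ∈ K := hp
    exact ⟨⟨p, by simp [localColouring, hp']⟩, hp⟩

theorem measurable_localColouring [TopologicalSpace M] [TopologicalSpace T]
    [ContinuousSMul T M] [MeasurableSpace T] [OpensMeasurableSpace T] [MeasurableSpace A]
    (P : Set M) {K : Set M} (hK : IsClosed K) (a : A) :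
    Measurable fun z : T × (P → A) => localColouring P K a z.1 z.2 := by
  refine measurable_pi_lambda _ fun p => Measurable.ite ?_ ?_ measurable_const
  · have hcl : IsClosed {x : T | x • (p : M) ∈ K} := hK.preimage (by fun_prop)
    exact hcl.measurableSet.preimage measurable_fst
  · exact (measurable_pi_apply p).comp measurable_snd

/-- The localised colouring is a function of the colours in the region moved into `K` by `x`. -/
theorem measurable_localColouring_localSigmaAlgebra [MeasurableSpace A] (P K : Set M) (a : A)
    (x : T) :
    Measurable[localSigmaAlgebra A P {m | x • m ∈ K}] fun ω : P → A =>
      localColouring P K a x ω := by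
  classical
  let h : ((P ∩ {m | x • m ∈ K} : Set M) → A) → P → A := fun η p =>
    if hp : x • (p : M) ∈ K then η ⟨p, p.2, hp⟩ else a
  have hh : Measurable h := by
    refine measurable_pi_lambda _ fun p => ?_
    by_cases hp : x • (p : M) ∈ K
    · simp only [h, dif_pos hp]
      exact measurable_pi_apply _
    · simp only [h, dif_neg hp]
      exact measurable_const
  have heq : (fun ω : P → A => localColouring P K a x ω) =
      h ∘ fun (ω : P → A) (q : (P ∩ {m | x • m ∈ K} : Set M)) => ω ⟨q, q.2.1⟩ := by
    funext ω p
    by_cases hp : x • (p : M) ∈ K <;> simp [localColouring, h, hp]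
  rw [heq]
  exact hh.comp (comap_measurable _)

/-- For a proper action, the set of elements not moving `K` away from `K'` is compact. -/
theorem isCompact_setOf_exists_smul_mem [TopologicalSpace M] [TopologicalSpace T] [ProperSMul T M]
    {K K' : Set M} (hK : IsCompact K) (hK' : IsCompact K') :
    IsCompact {t : T | ∃ k ∈ K, t • k ∈ K'} := by
  have h := ((ProperSMul.isProperMap_smul_pair (G := T) (X := M)).isCompact_preimage
    (hK'.prod hK)).image continuous_fst
  convert h using 1
  ext t
  constructor
  · rintro ⟨k, hk, hk'⟩
    exact ⟨(t, k), ⟨hk', hk⟩, rfl⟩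
  · rintro ⟨⟨s, k⟩, ⟨hk', hk⟩, rfl⟩
    exact ⟨k, hk, hk'⟩

/-- The regions moved into a ball by `x` and by `y` are far apart, unless `y * x⁻¹` moves a point
of this ball into a larger concentric ball. -/
theorem lt_iInf_edist_preimage_smul [MetricSpace M] [IsIsometricSMul T M] {ϱ : ℝ} (hϱ : 0 < ϱ)
    (o : M) (R : ℝ) {x y : T} (hxy : y * x⁻¹ ∉ {t : T | ∃ k ∈ Metric.closedBall o R,
      t • k ∈ Metric.closedBall o (ϱ + 1 + R)}) :
    ENNReal.ofReal ϱ < ⨅ p ∈ {m : M | x • m ∈ Metric.closedBall o R},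
      ⨅ q ∈ {m : M | y • m ∈ Metric.closedBall o R}, edist p q := by
  refine lt_of_lt_of_le ((ENNReal.ofReal_lt_ofReal_iff (by linarith)).2 (lt_add_one ϱ))
    (le_iInf₂ fun p hp => le_iInf₂ fun q hq => ?_)
  by_contra! hlt
  rw [edist_dist, ENNReal.ofReal_lt_ofReal_iff (by linarith), ← dist_smul y p q] at hlt
  refine hxy ⟨x • p, hp, ?_⟩
  rw [mul_smul, inv_smul_smul, Metric.mem_closedBall]
  have hq' : dist (y • q) o ≤ R := hq
  linarith [dist_triangle (y • p) (y • q) o]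

end Localisation

section FolnerSequence

variable {T : Type*} [Group T] [TopologicalSpace T] [MeasurableSpace T] {vol : Measure T}
  {D : ℕ → Set T}

theorem IsFolnerSequence.weaklyLocallyCompactSpace (hD : IsFolnerSequence vol D) :
    WeaklyLocallyCompactSpace T := by
  refine ⟨fun x => ?_⟩
  obtain ⟨n, hn⟩ := Set.mem_iUnion.1 (hD.iUnion_interior.ge (Set.mem_univ x))
  exact ⟨D n, hD.isCompact n, mem_interior_iff_mem_nhds.1 hn⟩

theorem IsFolnerSequence.iUnion_eq_univ (hD : IsFolnerSequence vol D) : ⋃ n, D n = Set.univ :=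
  Set.eq_univ_of_univ_subset
    (hD.iUnion_interior.ge.trans (Set.iUnion_mono fun _ => interior_subset))

theorem IsFolnerSequence.sigmaCompactSpace (hD : IsFolnerSequence vol D) : SigmaCompactSpace T :=
  SigmaCompactSpace.of_countable (Set.range D) (Set.countable_range D)
    (Set.forall_mem_range.2 hD.isCompact) (by rw [Set.sUnion_range, hD.iUnion_eq_univ])

theorem IsFolnerSequence.tendsto_measureReal [IsTopologicalGroup T] [NoncompactSpace T]
    [BorelSpace T] [vol.IsHaarMeasure] (hD : IsFolnerSequence vol D) :
    Tendsto (fun n => vol.real (D n)) atTop atTop := by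
  have := hD.weaklyLocallyCompactSpace
  have h := tendsto_measure_iUnion_atTop (μ := vol) hD.monotone
  rw [hD.iUnion_eq_univ, measure_univ_of_isMulLeftInvariant] at h
  refine tendsto_atTop.2 fun c => ?_
  filter_upwards [h.eventually (lt_mem_nhds (ENNReal.ofReal_lt_top (r := c)))] with n hn
  exact (ENNReal.ofReal_le_iff_le_toReal (hD.isCompact n).measure_lt_top.ne).1 hn.le

end FolnerSequence

/-! ### The strong law -/

/-- Passing to a uniformly `ε`-close random variable changes the deviation from the mean by at most
`2 * ε`. -/
theorem abs_sub_integral_le_add {Ω : Type*} {mΩ : MeasurableSpace Ω} {μ : Measure Ω}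
    [IsProbabilityMeasure μ] {Y Z : Ω → ℝ} {ε : ℝ} (hY : Integrable Y μ) (hZ : Integrable Z μ)
    (h : ∀ ω, |Y ω - Z ω| ≤ ε) (ω : Ω) :
    |Y ω - ∫ η, Y η ∂μ| ≤ |Z ω - ∫ η, Z η ∂μ| + 2 * ε := by
  have h1 : |∫ η, Y η ∂μ - ∫ η, Z η ∂μ| ≤ ε := by
    rw [← integral_sub hY hZ]
    simpa using norm_integral_le_of_norm_le_const (μ := μ) (f := fun η => Y η - Z η)
      (Eventually.of_forall h)
  have h2 := abs_le.1 (h ω)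
  have h3 := abs_le.1 h1
  have h4 := abs_le.1 (le_refl |Z ω - ∫ η, Z η ∂μ|)
  refine abs_le.2 ⟨?_, ?_⟩ <;> linarith

theorem abs_inv_mul_setIntegral_le {T : Type*} {mT : MeasurableSpace T} {vol : Measure T}
    {D : Set T} (hD : vol D ≠ ⊤) {g : T → ℝ} {C : ℝ} (hC : 0 ≤ C) (hg : ∀ x, |g x| ≤ C) :
    |(vol.real D)⁻¹ * ∫ x in D, g x ∂vol| ≤ C := by
  have h := norm_setIntegral_le_of_norm_le_const (μ := vol) (f := g) hD.lt_top (fun x _ => hg x)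
  rw [abs_mul, abs_of_nonneg (inv_nonneg.2 measureReal_nonneg)]
  refine (mul_le_mul_of_nonneg_left h (inv_nonneg.2 measureReal_nonneg)).trans ?_
  rw [mul_comm C, ← mul_assoc]
  exact mul_le_of_le_one_left hC (inv_mul_le_one)

theorem theorem3p6
    {M T A : Type*}
    -- the base space `M`, with its proper metric
    [MetricSpace M] [ProperSpace M] [Nonempty M]
    -- the metrisable, non-compact group `T`, acting continuously, properly, isometrically on `M`
    [Group T] [TopologicalSpace T] [IsTopologicalGroup T] [TopologicalSpace.MetrizableSpace T]
    [NoncompactSpace T] [MulAction T M] [ContinuousSMul T M] [ProperSMul T M]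
    [IsIsometricSMul T M]
    -- Haar measure on `T`; right invariance is unimodularity
    [MeasurableSpace T] [BorelSpace T]
    (vol : Measure T) [vol.IsHaarMeasure] [vol.IsMulRightInvariant]
    -- the colour space `A`
    [TopologicalSpace A] [Nonempty A] [LocallyCompactSpace A] [T2Space A]
    [SecondCountableTopology A] [MeasurableSpace A] [BorelSpace A]
    (r : ℝ) (hr : 0 < r)
    (D : ℕ → Set T) (hD : IsFolnerSequence vol D)
    (S : Set (PointSet M r))
    (f : ColouredPointSet M A r → ℝ) (hf : ContinuousOn f (closure (colouredHull T A S)))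
    (P : PointSet M r) (hP : P ∈ hull T S)
    (μ : Measure (P.1 → A)) [IsProbabilityMeasure μ] (hμ : IndependentAtDistance μ) :
    -- the averages and their expectations are well-defined
    (∀ n, ∀ ω : P.1 → A, IntegrableOn (fun x : T => f (x • colour P ω)) (D n) vol) ∧
    (∀ n, Integrable (fun ω => groupAverage vol (D n) f (colour P ω)) μ) ∧
    ∀ᵐ ω ∂μ, Tendsto
      (fun n => groupAverage vol (D n) f (colour P ω) -
        ∫ η, groupAverage vol (D n) f (colour P η) ∂μ)
      atTop (𝓝 0) := by
  have hWLC := hD.weaklyLocallyCompactSpace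
  have hSigma := hD.sigmaCompactSpace
  have hSC : SecondCountableTopology T := by
    let _ := TopologicalSpace.metrizableSpaceMetric T
    exact EMetric.secondCountable_of_sigmaCompact T
  have hcount : Countable P.1 := (P.2.countable hr).to_subtype
  have hmem : ∀ (x : T) (ω : P.1 → A), x • colour P ω ∈ closure (colouredHull T A S) :=
    fun x ω => subset_closure (smul_colour_mem_colouredHull hP x ω)
  have hDfin : ∀ n, vol (D n) ≠ ⊤ := fun n => (hD.isCompact n).measure_lt_top.ne
  -- `f` is bounded on the relevant compact set of coloured point sets.
  obtain ⟨C, hC⟩ : ∃ C : ℝ, ∀ Q ∈ closure (colouredHull T A S), |f Q| ≤ C := by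
    have := compactSpace_colouredPointSet (M := M) (A := A) hr
    exact isClosed_closure.isCompact.exists_bound_of_continuousOn hf
  obtain ⟨a⟩ := ‹Nonempty A›
  have hC0 : 0 ≤ C := (abs_nonneg _).trans (hC _ (hmem 1 fun _ => a))
  have hFcont : Continuous fun z : T × (P.1 → A) => f (z.1 • colour P z.2) :=
    hf.comp_continuous (continuous_smul_colour hr P) fun z => hmem z.1 z.2
  have hFmeas : Measurable fun z : T × (P.1 → A) => f (z.1 • colour P z.2) := hFcont.measurable
  have hint : ∀ n, ∀ ω : P.1 → A,
      IntegrableOn (fun x : T => f (x • colour P ω)) (D n) vol := fun n ω =>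
    (hFcont.comp (by fun_prop : Continuous fun x : T => (x, ω))).continuousOn.integrableOn_compact
      (hD.isCompact n)
  -- Averages of bounded measurable fields are integrable.
  have havg : ∀ (G : T → (P.1 → A) → ℝ), Measurable (Function.uncurry G) →
      (∀ x ω, |G x ω| ≤ C) → ∀ n,
        Integrable (fun ω => (vol.real (D n))⁻¹ * ∫ x in D n, G x ω ∂vol) μ :=
    fun G hG hGC n => Integrable.of_bound
      (hG.stronglyMeasurable.integral_prod_left.measurable.const_mul _).aestronglyMeasurable C
      (Eventually.of_forall fun ω => abs_inv_mul_setIntegral_le (hDfin n) hC0 fun x => hGC x ω)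
  have hYint : ∀ n, Integrable (fun ω => groupAverage vol (D n) f (colour P ω)) μ :=
    havg (fun x ω => f (x • colour P ω)) hFmeas fun x ω => hC _ (hmem x ω)
  refine ⟨hint, hYint, ?_⟩
  -- It suffices to control the centred averages up to each error `3 / (j + 1)`.
  suffices hsuff : ∀ j : ℕ, ∀ᵐ ω ∂μ, ∀ᶠ n in atTop,
      |groupAverage vol (D n) f (colour P ω) - ∫ η, groupAverage vol (D n) f (colour P η) ∂μ|
        ≤ 3 * (1 / ((j : ℝ) + 1)) by
    filter_upwards [ae_all_iff.2 hsuff] with ω hω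
    rw [Metric.tendsto_nhds]
    intro ε hε
    obtain ⟨j, hj⟩ := exists_nat_one_div_lt (show 0 < ε / 3 by positivity)
    filter_upwards [hω j] with n hn
    rw [dist_zero_right, Real.norm_eq_abs]
    linarith
  intro j
  set ε : ℝ := 1 / ((j : ℝ) + 1)
  have hε : 0 < ε := Nat.one_div_pos_of_nat
  obtain ⟨o⟩ := ‹Nonempty M›
  obtain ⟨R, hR⟩ := exists_radius_forall_abs_sub_le hr isClosed_closure hf o hε
  obtain ⟨ϱ, hϱ, hind⟩ := hμ
  have hK : IsClosed (Metric.closedBall o R) := Metric.isClosed_closedBall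
  -- The localised field `G`, uniformly `ε`-close to the original one.
  let G : T → (P.1 → A) → ℝ := fun x ω =>
    f (x • colour P (localColouring P.1 (Metric.closedBall o R) a x ω))
  have hG : Measurable (Function.uncurry G) :=
    hFmeas.comp (measurable_fst.prodMk (measurable_localColouring P.1 hK a))
  have hGC : ∀ x ω, |G x ω| ≤ C := fun x ω => hC _ (hmem x _)
  have hclose : ∀ x ω, |f (x • colour P ω) - G x ω| ≤ ε := fun x ω =>
    hR _ (hmem x ω) _ (hmem x _) (smul_colour_localColouring_inter P _ a x ω).symm
  have hGlocal : ∀ x, Measurable[localSigmaAlgebra A P.1 {m | x • m ∈ Metric.closedBall o R}]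
      (G x) := fun x =>
    (hFmeas.comp (measurable_prodMk_left (x := x))).comp
      (measurable_localColouring_localSigmaAlgebra P.1 _ a x)
  -- `G x` and `G y` can be dependent only if `y * x⁻¹` lies in the compact set `L`.
  let L : Set T := {t | ∃ k ∈ Metric.closedBall o R, t • k ∈ Metric.closedBall o (ϱ + 1 + R)}
  have hL : IsCompact L :=
    isCompact_setOf_exists_smul_mem (isCompact_closedBall o R) (isCompact_closedBall o _)
  have hLvol : ∀ x : T, vol ((fun y => y * x⁻¹) ⁻¹' L) = vol L := fun x =>
    measure_preimage_mul_right vol x⁻¹ L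
  have hlaw := ae_tendsto_centred_average (vol := vol) (μ := μ) (b := vol.real L) hG hGC
    (B := fun x => (fun y => y * x⁻¹) ⁻¹' L)
    (fun x => hL.measurableSet.preimage (measurable_mul_const x⁻¹))
    (fun x => by rw [hLvol]; exact hL.measure_lt_top.ne)
    (fun x => by rw [measureReal_def, hLvol, measureReal_def])
    (fun x y hy => by
      rw [IndepFun_iff_Indep]
      exact indep_of_indep_of_le_left (indep_of_indep_of_le_right
        (hind _ _ (lt_iInf_edist_preimage_smul hϱ o R hy)) (hGlocal y).comap_le)
        (hGlocal x).comap_le)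
    hD.monotone (fun n => (hD.isCompact n).measurableSet) hDfin hD.tendsto_measureReal
  filter_upwards [hlaw] with ω hω
  filter_upwards [Metric.tendsto_nhds.1 hω ε hε] with n hn
  rw [dist_zero_right, Real.norm_eq_abs] at hn
  have hGint : ∀ ω, IntegrableOn (fun x => G x ω) (D n) vol := fun ω =>
    Measure.integrableOn_of_bounded (hDfin n)
      (hG.comp measurable_prodMk_right).aestronglyMeasurable
      (Eventually.of_forall fun x => hGC x ω)
  refine (abs_sub_integral_le_add (hYint n) (havg G hG hGC n) (ε := ε) (fun ω => ?_) ω).trans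
    (by linarith)
  rw [groupAverage, ← mul_sub, ← integral_sub (hint n ω) (hGint ω)]
  exact abs_inv_mul_setIntegral_le (hDfin n) hε.le fun x => hclose x ω
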